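/- Let $X$ be a measurable space (for instance a countable set with all subsets measurable), let $F$ be any set of functions from $X$ to $[0,1]$, let $\gamma>0$ and let $m$ be a positive integer. For $r\in[0,1]$ and $y\in[0,1]$ put $\psi_{r,\gamma}(y)=1$ if $y\ge r+\gamma$, $\psi_{r,\gamma}(y)=0$ if $y\le r-\gamma$, and $\psi_{r,\gamma}(y)=\star$ if $|y-r|<\gamma$. Let $\mathrm{fatV}_F(\gamma)\in\{0,1,2,\dots\}\cup\{\infty\}$ be the supremum of all $d\ge 0$ for which there are $r\in[0,1]$ and $x_1,\dots,x_d\in X$ with $$\{0,1\}^d\subseteq\{(\psi_{r,\gamma}(f(x_1)),\dots,\psi_{r,\gamma}(f(x_d))) : f\in F\}$$ (with value $0$ if $F=\emptyset$). A prediction strategy is any map $A:\bigl(\bigcup_{n\ge 0}(X\times[0,1])^n\bigr)\times X\to[0,1]$. Let $$\mathcal L(F,m)=\inf_A\ \sup_{D,\,f}\ \int_{X^m}\bigl|A\bigl(((x_1,f(x_1)),\dots,(x_{m-1},f(x_{m-1}))),x_m\bigr)-f(x_m)\bigr|\,dD^m(x_1,\dots,x_m),$$ where the infimum is over all prediction strategies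 $A$ and the supremum is over all probability measures $D$ on $X$ and all $f\in F$ (a supremum over the empty set being $0$). No measurability of $A$ or $f$ is required: if the integrand is not measurable, the integral is understood as the lower integral, i.e. the supremum of the integrals of the measurable functions with values in $[0,\infty]$ that lie below the integrand (for a countable set $X$ with all subsets measurable, every integrand is measurable and this is the ordinary integral). Then $$\mathcal L(F,m)\le\frac{\mathrm{fatV}_F(\gamma)}{m}+\gamma .$$ -/

import Mathlib

open MeasureTheory
open scoped unitInterval ENNReal

noncomputable section

/-- The values `0`, `1` and "don't care" (`⋆`). -/
inductive DCLabel where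
  | zero
  | star
  | one

/-- The label in `{0, 1} ⊆ {0, ⋆, 1}` named by a bit. -/
def DCLabel.ofBool : Bool → DCLabel
  | false => DCLabel.zero
  | true => DCLabel.one

open Classical in
/-- `ψ_{r,γ}(y)` is `1` if `y ≥ r + γ`, `0` if `y ≤ r - γ`, and `⋆` if `|y - r| < γ`
(for `γ > 0` the three cases exclude each other and cover everything). -/
def psi (r γ y : ℝ) : DCLabel :=
  if r + γ ≤ y then DCLabel.one
  else if y ≤ r - γ then DCLabel.zero
  else DCLabel.star

/-- The sequence `x₁, …, x_d` is `γ`-fatly Vapnik-shattered by `F`: for a single threshold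
`r ∈ [0,1]`, every bit vector is `(ψ_{r,γ}(f x₁), …, ψ_{r,γ}(f x_d))` for some `f ∈ F`. -/
def FatlyVapnikShattered {X : Type*} (F : Set (X → I)) (γ : ℝ) {d : ℕ} (x : Fin d → X) : Prop :=
  ∃ r : I, ∀ b : Fin d → Bool, ∃ f ∈ F, ∀ i, psi (r : ℝ) γ (f (x i) : ℝ) = DCLabel.ofBool (b i)

/-- `fatV_F(γ)`: the length of the longest `γ`-fatly Vapnik-shattered sequence, `∞` if there
are arbitrarily long ones. -/
def fatV {X : Type*} (F : Set (X → I)) (γ : ℝ) : ℕ∞ :=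
  ⨆ (d : ℕ) (_ : ∃ x : Fin d → X, FatlyVapnikShattered F γ x), (d : ℕ∞)

/-- A prediction strategy maps a finite sequence of labelled examples and a further point
to a prediction in `[0,1]`. -/
abbrev PredictionStrategy (X : Type*) := List (X × I) → X → I

/-- The labelled examples `(x₁, f x₁), …, (x_{m-1}, f x_{m-1})`. -/
def trainingSample {X : Type*} (f : X → I) {m : ℕ} (x : Fin m → X) : List (X × I) :=
  List.ofFn fun i : Fin (m - 1) =>
    (x (i.castLE (Nat.sub_le m 1)), f (x (i.castLE (Nat.sub_le m 1))))

/-- The last point `x_m` of a sequence of `m ≥ 1` points. -/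
def lastPoint {X : Type*} {m : ℕ} (hm : 0 < m) (x : Fin m → X) : X :=
  x ⟨m - 1, Nat.sub_lt hm Nat.one_pos⟩

/-- The absolute error of the strategy `A` on `x_m` after the first `m - 1` examples of `f`. -/
def predictionError {X : Type*} (A : PredictionStrategy X) (f : X → I) {m : ℕ} (hm : 0 < m)
    (x : Fin m → X) : ℝ :=
  |(A (trainingSample f x) (lastPoint hm x) : ℝ) - (f (lastPoint hm x) : ℝ)|

/-- `L(F, m)`: infimum over all prediction strategies of the supremum, over all probability
measures `D` on `X` and all `f ∈ F`, of the `D^m`-integral of the absolute error. -/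
def predictionLoss {X : Type*} [MeasurableSpace X] (F : Set (X → I)) (m : ℕ) (hm : 0 < m) :
    ℝ≥0∞ :=
  ⨅ A : PredictionStrategy X, ⨆ (D : ProbabilityMeasure X) (f : X → I) (_ : f ∈ F),
    ∫⁻ x : Fin m → X, ENNReal.ofReal (predictionError A f hm x)
      ∂(Measure.pi fun _ : Fin m => (D : Measure X))

end

/-! Let `d` be the value of `fatV`, assumed finite. At one threshold, the traces without `⋆` form a
family of VC dimension at most `d`. Its one-inclusion graph has at most `d` edges per vertex, so
Hall's theorem orients it with out-degrees at most `d`; predicting along the orientation contradicts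
at most `d` labels when each sample point is left out in turn (`exists_threshold_rule`). Averaging
these 0/1 predictions over the thresholds `k / N` approximates `f` within `γ + 1 / N`, plus the
fraction of contradicted labels. Double counting bounds the total leave-one-out error by `d + m * (γ
+ 1 / N)` (`exists_strategy_leaveOneOut`). Exchangeability of the sample divides this by `m`, and `N
→ ∞` removes `1 / N`. -/

namespace Finset

/-! ### One-inclusion graphs -/

variable {α : Type*} [DecidableEq α]

/-- The edges in direction `a` of the one-inclusion graph of `𝒜`, named by their endpoint that
avoids `a`. -/
def oneInclusionEdges (𝒜 : Finset (Finset α)) (a : α) : Finset (Finset α) :=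
  𝒜.memberSubfamily a ∩ 𝒜.nonMemberSubfamily a

theorem mem_oneInclusionEdges {𝒜 : Finset (Finset α)} {a : α} {P : Finset α} :
    P ∈ 𝒜.oneInclusionEdges a ↔ insert a P ∈ 𝒜 ∧ P ∈ 𝒜 ∧ a ∉ P := by
  simp only [oneInclusionEdges, mem_inter, mem_memberSubfamily, mem_nonMemberSubfamily]
  tauto

/-- Split the `a`-edges by whether they contain `b` and use |E| + |E'| = |E ∪ E'| + |E ∩ E'|: the
union lies in the projection of `𝒜` along `b`, and the intersection joins `b`-edges. -/
theorem card_oneInclusionEdges_le (𝒜 : Finset (Finset α)) {a b : α} (h : a ≠ b) :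
    (𝒜.oneInclusionEdges a).card ≤
      ((𝒜.memberSubfamily b ∪ 𝒜.nonMemberSubfamily b).oneInclusionEdges a).card +
        ((𝒜.oneInclusionEdges b).oneInclusionEdges a).card := by
  have hU : (𝒜.memberSubfamily b).oneInclusionEdges a ∪
      (𝒜.nonMemberSubfamily b).oneInclusionEdges a ⊆
      (𝒜.memberSubfamily b ∪ 𝒜.nonMemberSubfamily b).oneInclusionEdges a := by
    intro P hP
    simp only [mem_union, mem_oneInclusionEdges] at hP ⊢
    tauto
  have hI : (𝒜.memberSubfamily b).oneInclusionEdges a ∩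
      (𝒜.nonMemberSubfamily b).oneInclusionEdges a ⊆
      (𝒜.oneInclusionEdges b).oneInclusionEdges a := by
    intro P hP
    rw [oneInclusionEdges.eq_1 𝒜]
    simp only [mem_inter, mem_oneInclusionEdges] at hP ⊢
    tauto
  have hm : (𝒜.oneInclusionEdges a).memberSubfamily b ⊆
      (𝒜.memberSubfamily b).oneInclusionEdges a := by
    intro P hP
    simp only [mem_memberSubfamily, mem_oneInclusionEdges, mem_insert,
      insert_comm a b] at hP ⊢
    have := h.symm
    tauto
  have hn : (𝒜.oneInclusionEdges a).nonMemberSubfamily b ⊆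
      (𝒜.nonMemberSubfamily b).oneInclusionEdges a := by
    intro P hP
    simp only [mem_nonMemberSubfamily, mem_oneInclusionEdges, mem_insert] at hP ⊢
    have := h.symm
    tauto
  rw [← card_memberSubfamily_add_card_nonMemberSubfamily b]
  calc _ ≤ _ := Nat.add_le_add (card_le_card hm) (card_le_card hn)
    _ = _ := (card_union_add_card_inter _ _).symm
    _ ≤ _ := Nat.add_le_add (card_le_card hU) (card_le_card hI)

theorem Shatters.of_memberSubfamily_union {𝒜 : Finset (Finset α)} {s : Finset α} {b : α}
    (hs : (𝒜.memberSubfamily b ∪ 𝒜.nonMemberSubfamily b).Shatters s) : 𝒜.Shatters s := by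
  have hb : b ∉ s := by
    obtain ⟨u, hu, hsu⟩ := hs.exists_superset
    simp only [mem_union, mem_memberSubfamily, mem_nonMemberSubfamily] at hu
    exact fun hb ↦ hu.elim (fun h ↦ h.2 (hsu hb)) (fun h ↦ h.2 (hsu hb))
  intro t ht
  obtain ⟨u, hu, rfl⟩ := hs ht
  simp only [mem_union, mem_memberSubfamily, mem_nonMemberSubfamily] at hu
  obtain hu | hu := hu
  · exact ⟨_, hu.1, inter_insert_of_notMem hb⟩
  · exact ⟨_, hu.1, rfl⟩

/-- A `b`-edge offers both choices at `b`, so the family of `b`-edges loses one dimension. -/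
theorem Shatters.insert_of_oneInclusionEdges {𝒜 : Finset (Finset α)} {s : Finset α} {b : α}
    (hs : (𝒜.oneInclusionEdges b).Shatters s) : b ∉ s ∧ 𝒜.Shatters (insert b s) := by
  have hb : b ∉ s := by
    obtain ⟨u, hu, hsu⟩ := hs.exists_superset
    exact fun hb ↦ (mem_oneInclusionEdges.1 hu).2.2 (hsu hb)
  refine ⟨hb, fun t ht ↦ ?_⟩
  obtain ⟨u, hu, hsu⟩ := hs (subset_insert_iff.1 ht)
  rw [mem_oneInclusionEdges] at hu
  by_cases hbt : b ∈ t
  · exact ⟨_, hu.1, by rw [← insert_inter_distrib, hsu, insert_erase hbt]⟩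
  · exact ⟨_, hu.2.1, by rw [insert_inter_of_notMem hu.2.2, hsu, erase_eq_of_notMem hbt]⟩

/-- The one-inclusion graph of a family of VC dimension at most `d` has at most `d` times as many
edges as vertices. -/
theorem sum_card_oneInclusionEdges_le (S : Finset α) (𝒜 : Finset (Finset α)) (d : ℕ)
    (hd : ∀ s, 𝒜.Shatters s → s.card ≤ d) :
    ∑ a ∈ S, (𝒜.oneInclusionEdges a).card ≤ d * 𝒜.card := by
  induction S using Finset.induction_on generalizing 𝒜 d with
  | empty => simp
  | insert b S hb ih =>
    have hU := ih (𝒜.memberSubfamily b ∪ 𝒜.nonMemberSubfamily b) d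
      fun s hs ↦ hd s hs.of_memberSubfamily_union
    -- The dimension lost by the `b`-edges pays for counting the `b`-edges themselves.
    have hW : ∑ a ∈ S, ((𝒜.oneInclusionEdges b).oneInclusionEdges a).card +
        (𝒜.oneInclusionEdges b).card ≤ d * (𝒜.oneInclusionEdges b).card := by
      have hd' : ∀ s, (𝒜.oneInclusionEdges b).Shatters s → s.card + 1 ≤ d := fun s hs ↦ by
        have h := hs.insert_of_oneInclusionEdges
        rw [← card_insert_of_notMem h.1]
        exact hd _ h.2
      rcases (𝒜.oneInclusionEdges b).eq_empty_or_nonempty with h0 | hne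
      · simp only [h0]
        simp [oneInclusionEdges, memberSubfamily, nonMemberSubfamily]
      · obtain _ | e := d
        · simpa using hd' ∅ (shatters_empty.2 hne)
        · have := ih (𝒜.oneInclusionEdges b) e fun s hs ↦ by have := hd' s hs; omega
          rw [Nat.add_mul, one_mul]
          omega
    have hsum := sum_le_sum fun a (ha : a ∈ S) ↦
      card_oneInclusionEdges_le 𝒜 (b := b) fun h ↦ hb (h ▸ ha)
    rw [sum_add_distrib] at hsum
    have hc : (𝒜.memberSubfamily b ∪ 𝒜.nonMemberSubfamily b).card +
        (𝒜.oneInclusionEdges b).card = 𝒜.card := by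
      rw [oneInclusionEdges, card_union_add_card_inter,
        card_memberSubfamily_add_card_nonMemberSubfamily]
    rw [sum_insert hb, ← hc, mul_add]
    omega

/-- The edges of the one-inclusion graph can be oriented with out-degrees at most `d`. -/
theorem exists_oneInclusion_orientation (S : Finset α) (𝒜 : Finset (Finset α)) (d : ℕ)
    (hd : ∀ s, 𝒜.Shatters s → s.card ≤ d) :
    ∃ g : (S.sigma fun a ↦ 𝒜.oneInclusionEdges a) → Finset α × ℕ, Function.Injective g ∧
      ∀ e, g e ∈ ({e.1.2, insert e.1.1 e.1.2} : Finset (Finset α)) ×ˢ range d := by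
  -- Hall's theorem, with `d` slots at each vertex; Hall's condition is the edge bound for the
  -- subfamily of endpoints of `s`.
  rw [← all_card_le_biUnion_card_iff_exists_injective]
  intro s
  set 𝒱 : Finset (Finset α) := s.biUnion fun e ↦ {e.1.2, insert e.1.1 e.1.2} with h𝒱
  have hsub : 𝒱 ⊆ 𝒜 := by
    intro P hP
    simp only [h𝒱, mem_biUnion, mem_insert, mem_singleton] at hP
    obtain ⟨e, -, he⟩ := hP
    have := mem_oneInclusionEdges.1 (mem_sigma.1 e.2).2
    rcases he with rfl | rfl
    exacts [this.2.1, this.1]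
  have hmap : s.map (Function.Embedding.subtype _) ⊆ S.sigma fun a ↦ 𝒱.oneInclusionEdges a := by
    intro e he
    simp only [mem_map, Function.Embedding.coe_subtype] at he
    obtain ⟨e, hes, rfl⟩ := he
    have h := mem_sigma.1 e.2
    refine mem_sigma.2 ⟨h.1, mem_oneInclusionEdges.2
      ⟨mem_biUnion.2 ⟨e, hes, by simp⟩, mem_biUnion.2 ⟨e, hes, by simp⟩,
        (mem_oneInclusionEdges.1 h.2).2.2⟩⟩
  have hprod : s.biUnion (fun e ↦ ({e.1.2, insert e.1.1 e.1.2} : Finset (Finset α)) ×ˢ range d) =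
      𝒱 ×ˢ range d := by
    ext ⟨P, k⟩
    simp only [h𝒱, mem_biUnion, mem_product]
    exact ⟨fun ⟨e, he, h1, h2⟩ ↦ ⟨⟨e, he, h1⟩, h2⟩, fun ⟨⟨e, he, h1⟩, h2⟩ ↦ ⟨e, he, h1, h2⟩⟩
  rw [hprod, card_product, card_range, mul_comm]
  have hle := card_le_card hmap
  rw [card_map, card_sigma] at hle
  exact hle.trans (sum_card_oneInclusionEdges_le S 𝒱 d fun s hs ↦ hd s (hs.mono_left hsub))

/-- The one-inclusion prediction rule: from a member `P` of a family of VC dimension at most `d`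
with the point `a` erased it predicts whether `a ∈ P`, wrongly for at most `d` points `a`. -/
theorem exists_oneInclusion_rule (S : Finset α) (𝒜 : Finset (Finset α)) (d : ℕ)
    (hd : ∀ s, 𝒜.Shatters s → s.card ≤ d) :
    ∃ p : Finset α → α → Prop, ∀ P ∈ 𝒜, ∀ B ⊆ S,
      (∀ a ∈ B, ¬ (p (P.erase a) a ↔ a ∈ P)) → B.card ≤ d := by
  classical
  obtain ⟨g, hg, hgm⟩ := exists_oneInclusion_orientation S 𝒜 d hd
  let E := S.sigma fun a ↦ 𝒜.oneInclusionEdges a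
  -- On an edge, predict the endpoint to which it is not charged: each error at `P` then uses up one
  -- of the `d` slots of `P`.
  refine ⟨fun Q a ↦ if h : (⟨a, Q⟩ : Σ _ : α, Finset α) ∈ E then (g ⟨⟨a, Q⟩, h⟩).1 = Q
    else insert a Q ∈ 𝒜, fun P hP B hBS hB ↦ ?_⟩
  have key : ∀ a ∈ B, ∃ h : (⟨a, P.erase a⟩ : Σ _ : α, Finset α) ∈ E,
      (g ⟨⟨a, P.erase a⟩, h⟩).1 = P := by
    intro a ha
    have hBa := hB a ha
    by_cases h : (⟨a, P.erase a⟩ : Σ _ : α, Finset α) ∈ E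
    · refine ⟨h, ?_⟩
      simp only [dif_pos h] at hBa
      have hm := (mem_product.1 (hgm ⟨_, h⟩)).1
      rw [mem_insert, mem_singleton] at hm
      by_cases haP : a ∈ P
      · simp only [haP, iff_true] at hBa
        rw [hm.resolve_left hBa]
        exact insert_erase haP
      · simp only [haP, iff_false, not_not] at hBa
        rw [hBa, erase_eq_of_notMem haP]
    · exfalso
      simp only [dif_neg h] at hBa
      apply hBa
      by_cases haP : a ∈ P
      · simp [haP, insert_erase haP, hP]
      · simp only [haP, iff_false, erase_eq_of_notMem haP] at h ⊢
        exact fun hin ↦ h (mem_sigma.2 ⟨hBS ha, mem_oneInclusionEdges.2 ⟨hin, hP, haP⟩⟩)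
  choose hE hgP using key
  calc B.card = B.attach.card := by simp
    _ ≤ (range d).card := card_le_card_of_injOn
      (fun a ↦ (g ⟨⟨a.1, P.erase a.1⟩, hE a.1 a.2⟩).2)
      (fun a _ ↦ (mem_product.1 (hgm ⟨_, hE a.1 a.2⟩)).2) (by
        intro a _ b _ hab
        have := hg (Prod.ext ((hgP a.1 a.2).trans (hgP b.1 b.2).symm) hab)
        simp only [Subtype.mk.injEq, Sigma.mk.injEq] at this
        exact Subtype.ext this.1)
    _ = d := card_range d

end Finset

/-! ### Prediction at a single threshold -/

theorem psi_eq_one_iff {r γ y : ℝ} : psi r γ y = DCLabel.one ↔ r + γ ≤ y := by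
  unfold psi
  split_ifs <;> simp_all

theorem psi_eq_zero_iff {r γ y : ℝ} (hγ : 0 < γ) : psi r γ y = DCLabel.zero ↔ y ≤ r - γ := by
  unfold psi
  split_ifs with h1 h2
  · simp only [false_iff, not_le]
    linarith
  · simp [h2]
  · simp [h2]

theorem DCLabel.eq_ofBool_decide_eq_one {l : DCLabel} (h : l ≠ DCLabel.star) [Decidable (l = one)] :
    l = DCLabel.ofBool (decide (l = one)) := by
  cases l <;> simp_all [DCLabel.ofBool]

open Classical in
/-- The traces on `S` of the functions in `F` that have no `⋆` on `S` at threshold `r`. -/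
noncomputable def thresholdTraces {X : Type*} (F : Set (X → I)) (γ : ℝ) (r : I) (S : Finset X) :
    Finset (Finset X) :=
  S.powerset.filter fun P ↦
    ∃ f ∈ F, ∀ a ∈ S, psi r γ (f a) = DCLabel.ofBool (decide (a ∈ P))

open Classical in
theorem exists_fatlyVapnikShattered_of_shatters {X : Type*} {F : Set (X → I)} {γ : ℝ} {r : I}
    {S s : Finset X} (hs : (thresholdTraces F γ r S).Shatters s) :
    ∃ x : Fin s.card → X, FatlyVapnikShattered F γ x := by
  refine ⟨fun i ↦ s.equivFin.symm i, r, fun b ↦ ?_⟩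
  obtain ⟨u, hu, hsu⟩ := hs (t := s.filter fun a ↦ ∃ h : a ∈ s, b (s.equivFin ⟨a, h⟩) = true)
    (Finset.filter_subset _ _)
  obtain ⟨v, hv, hsv⟩ := hs.exists_superset
  have hsS : s ⊆ S :=
    hsv.trans (Finset.mem_powerset.1 (Finset.mem_filter.1 hv).1)
  obtain ⟨-, f, hf, hfu⟩ := Finset.mem_filter.1 hu
  refine ⟨f, hf, fun i ↦ ?_⟩
  rw [hfu _ (hsS (s.equivFin.symm i).2)]
  congr 1
  have hi := (s.equivFin.symm i).2
  have := congrArg (fun t ↦ ((s.equivFin.symm i : s) : X) ∈ t) hsu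
  simp only [Finset.mem_inter, hi, true_and, Finset.mem_filter, Subtype.coe_eta,
    Equiv.apply_symm_apply, exists_const, eq_iff_iff] at this
  rw [Bool.eq_iff_iff, decide_eq_true_iff, this]

open Classical in
/-- The points in a labelled sample whose label at threshold `r` satisfies `p`. -/
noncomputable def pointsWithLabel {X : Type*} (γ : ℝ) (r : I) (p : DCLabel → Prop) (L : List (X × I)) :
    Finset X :=
  (L.toFinset.filter fun z ↦ p (psi r γ z.2)).image Prod.fst

theorem mem_pointsWithLabel {X : Type*} {γ : ℝ} {r : I} {p : DCLabel → Prop}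
    {L : List (X × I)} {a : X} :
    a ∈ pointsWithLabel γ r p L ↔ ∃ y : I, (a, y) ∈ L ∧ p (psi r γ y) := by
  simp [pointsWithLabel]

/-- `L i` lists the examples labelled by `f` at all the points `x j` with `j ≠ i`. -/
def IsLeaveOneOut {X : Type*} {m : ℕ} (f : X → I) (x : Fin m → X) (L : Fin m → List (X × I)) :
    Prop :=
  ∀ i z, z ∈ L i ↔ ∃ j ≠ i, z = (x j, f (x j))

theorem IsLeaveOneOut.mem_pointsWithLabel {X : Type*} {m : ℕ} {f : X → I} {x : Fin m → X}
    {L : Fin m → List (X × I)} (hL : IsLeaveOneOut f x L) {γ : ℝ} {r : I} {p : DCLabel → Prop}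
    {i : Fin m} {a : X} :
    a ∈ pointsWithLabel γ r p (L i) ↔ (∃ j ≠ i, x j = a) ∧ p (psi r γ (f a)) := by
  simp only [_root_.mem_pointsWithLabel, hL i, Prod.mk.injEq]
  constructor
  · rintro ⟨y, ⟨j, hj, rfl, rfl⟩, hp⟩
    exact ⟨⟨j, hj, rfl⟩, hp⟩
  · rintro ⟨⟨j, hj, rfl⟩, hp⟩
    exact ⟨_, ⟨j, hj, rfl, rfl⟩, hp⟩

open Classical in
/-- At a fixed threshold there is a prediction rule whose leave-one-out predictions contradict
at most `d` of the labels other than `⋆`. -/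
theorem exists_threshold_rule {X : Type*} (F : Set (X → I)) (γ : ℝ) (d : ℕ)
    (hd : ∀ (n : ℕ) (x : Fin n → X), FatlyVapnikShattered F γ x → n ≤ d) (r : I) :
    ∃ h : List (X × I) → X → Prop, ∀ f ∈ F, ∀ (m : ℕ) (x : Fin m → X) (L : Fin m → List (X × I)),
      IsLeaveOneOut f x L → ∀ B : Finset (Fin m),
      (∀ i ∈ B, psi r γ (f (x i)) ≠ DCLabel.star ∧
        ¬ (h (L i) (x i) ↔ psi r γ (f (x i)) = DCLabel.one)) → B.card ≤ d := by
  choose p hp using fun S ↦ Finset.exists_oneInclusion_rule S (thresholdTraces F γ r S) d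
    fun s hs ↦ by
      obtain ⟨x, hx⟩ := exists_fatlyVapnikShattered_of_shatters hs
      exact hd _ x hx
  -- Repeat a known label; otherwise apply the one-inclusion rule on the known non-`⋆` points
  -- together with `a`.
  refine ⟨fun L a ↦ if a ∈ pointsWithLabel γ r (· ≠ DCLabel.star) L
    then a ∈ pointsWithLabel γ r (· = DCLabel.one) L
    else p (insert a (pointsWithLabel γ r (· ≠ DCLabel.star) L))
      (pointsWithLabel γ r (· = DCLabel.one) L) a, fun f hf m x L hL B hB ↦ ?_⟩
  set S : Finset X := (Finset.univ.image x).filter fun a ↦ psi r γ (f a) ≠ DCLabel.star with hS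
  set P : Finset X := S.filter fun a ↦ psi r γ (f a) = DCLabel.one with hP
  have hPS : P ∈ thresholdTraces F γ r S := by
    refine Finset.mem_filter.2 ⟨Finset.mem_powerset.2 (Finset.filter_subset _ _), f, hf,
      fun a ha ↦ ?_⟩
    refine (DCLabel.eq_ofBool_decide_eq_one (Finset.mem_filter.1 ha).2).trans ?_
    congr 1
    simp only [decide_eq_decide]
    simp [hP, ha]
  -- Repeated points are predicted correctly, so errors occur at distinct points.
  have hnew : ∀ i ∈ B, ∀ j ≠ i, x j ≠ x i := by
    intro i hi j hj hji
    obtain ⟨h1, h2⟩ := hB i hi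
    apply h2
    have hex : ∃ j ≠ i, x j = x i := ⟨j, hj, hji⟩
    have hold : x i ∈ pointsWithLabel γ r (· ≠ DCLabel.star) (L i) :=
      hL.mem_pointsWithLabel.2 ⟨hex, h1⟩
    simp only [if_pos hold]
    rw [hL.mem_pointsWithLabel]
    exact and_iff_right hex
  have hinj : Set.InjOn x B := fun i _ j hj hij ↦ by
    by_contra hne
    exact hnew j hj i hne hij
  rw [← Finset.card_image_of_injOn hinj]
  refine hp S P hPS (B.image x) ?_ ?_
  · intro a ha
    obtain ⟨i, hi, rfl⟩ := Finset.mem_image.1 ha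
    exact Finset.mem_filter.2 ⟨Finset.mem_image_of_mem _ (Finset.mem_univ _), (hB i hi).1⟩
  · intro a ha
    obtain ⟨i, hi, rfl⟩ := Finset.mem_image.1 ha
    obtain ⟨h1, h2⟩ := hB i hi
    have hnot : ¬ ∃ j ≠ i, x j = x i := fun ⟨j, hj, hji⟩ ↦ hnew i hi j hj hji
    have hpts : ∀ a, a ∈ Finset.univ.image x ↔ a = x i ∨ ∃ j ≠ i, x j = a := by
      intro a
      simp only [Finset.mem_image, Finset.mem_univ, true_and]
      constructor
      · rintro ⟨j, rfl⟩
        by_cases hj : j = i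
        · exact .inl (hj ▸ rfl)
        · exact .inr ⟨j, hj, rfl⟩
      · rintro (rfl | ⟨j, -, rfl⟩) <;> exact ⟨_, rfl⟩
    -- Since the label of `x i` is not `⋆`, the rule recovers `S` without seeing that label; hence
    -- all errors refer to the same graph.
    have hSi : insert (x i) (pointsWithLabel γ r (· ≠ DCLabel.star) (L i)) = S := by
      ext a
      rw [Finset.mem_insert, hL.mem_pointsWithLabel, hS, Finset.mem_filter, hpts]
      by_cases ha : a = x i
      · simp [ha, h1]
      · simp [ha]
    have hPi : pointsWithLabel γ r (· = DCLabel.one) (L i) = P.erase (x i) := by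
      ext a
      rw [hL.mem_pointsWithLabel, Finset.mem_erase, hP, Finset.mem_filter, hS, Finset.mem_filter,
        hpts]
      by_cases ha : a = x i
      · rw [ha]
        simp [hnot]
      · simp only [ha, false_or, not_false_eq_true, ne_eq, true_and]
        constructor
        · rintro ⟨h3, h4⟩
          exact ⟨⟨h3, by simp [h4]⟩, h4⟩
        · rintro ⟨⟨h3, -⟩, h4⟩
          exact ⟨h3, h4⟩
    have hnew' : x i ∉ pointsWithLabel γ r (· ≠ DCLabel.star) (L i) :=
      fun h ↦ hnot (hL.mem_pointsWithLabel.1 h).1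
    simp only [if_neg hnew'] at h2
    rw [hSi, hPi] at h2
    convert h2 using 2
    have hxS : x i ∈ S := hSi ▸ Finset.mem_insert_self _ _
    rw [hP, Finset.mem_filter]
    simp [hxS]

/-! ### Averaging over thresholds -/

theorem card_le_of_forall_lt {c : ℝ} (hc : 0 ≤ c) (s : Finset ℕ)
    (hs : ∀ k ∈ s, (k : ℝ) < c) : (s.card : ℝ) ≤ c + 1 := by
  have hsub : s ⊆ Finset.range ⌈c⌉₊ := fun k hk ↦ Finset.mem_range.2 (Nat.lt_ceil.2 (hs k hk))
  have := Finset.card_le_card hsub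
  rw [Finset.card_range] at this
  exact (Nat.cast_le.2 this).trans (Nat.ceil_lt_add_one hc).le

theorem card_le_of_forall_gt (N : ℕ) {c : ℝ} (hc : c ≤ N) (s : Finset ℕ)
    (hs : ∀ k ∈ s, k < N ∧ c < k) : (s.card : ℝ) ≤ N - c := by
  have hsub : s ⊆ Finset.Ico ⌈c⌉₊ N := fun k hk ↦
    Finset.mem_Ico.2 ⟨Nat.ceil_le.2 (hs k hk).2.le, (hs k hk).1⟩
  have := Finset.card_le_card hsub
  rw [Nat.card_Ico] at this
  calc (s.card : ℝ) ≤ ((N - ⌈c⌉₊ : ℕ) : ℝ) := Nat.cast_le.2 this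
    _ = N - ⌈c⌉₊ := Nat.cast_sub (Nat.ceil_le.2 hc)
    _ ≤ N - c := sub_le_sub_left (Nat.le_ceil c) _

open Classical in
/-- The average of threshold predictions at the thresholds `k / N` is within `γ + 1 / N` of `y`,
up to the proportion of predictions contradicting a label other than `⋆`. -/
theorem abs_card_filter_div_sub_le {N : ℕ} (hN : 0 < N) {γ : ℝ} (hγ : 0 < γ) (y : I)
    (q : ℕ → Prop) :
    |(((Finset.range N).filter q).card : ℝ) / N - y| ≤ γ + 1 / N +
      (((Finset.range N).filter fun k : ℕ ↦ psi ((k : ℝ) / N) γ y ≠ DCLabel.star ∧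
        ¬ (q k ↔ psi ((k : ℝ) / N) γ y = DCLabel.one)).card : ℝ) / N := by
  set bad := (Finset.range N).filter fun k : ℕ ↦ psi ((k : ℝ) / N) γ y ≠ DCLabel.star ∧
    ¬ (q k ↔ psi ((k : ℝ) / N) γ y = DCLabel.one) with hbad
  have hN' : (0 : ℝ) < N := Nat.cast_pos.2 hN
  have hy0 : (0 : ℝ) ≤ y := y.2.1
  have hy1 : (y : ℝ) ≤ 1 := y.2.2
  -- Predicting 1 at a threshold at least `y + γ` is an error; rounding costs the 1 that becomes `1
  -- / N`.
  have hup : (((Finset.range N).filter q).card : ℝ) ≤ N * (y + γ) + 1 + bad.card := by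
    have hsub : (Finset.range N).filter q ⊆
        ((Finset.range N).filter fun k : ℕ ↦ (k : ℝ) < N * (y + γ)) ∪ bad := by
      intro k hk
      rw [Finset.mem_filter] at hk
      rw [Finset.mem_union, Finset.mem_filter]
      by_cases hlt : (k : ℝ) < N * (y + γ)
      · exact .inl ⟨hk.1, hlt⟩
      · have h0 : psi ((k : ℝ) / N) γ y = DCLabel.zero := by
          rw [psi_eq_zero_iff hγ, le_sub_iff_add_le, le_div_iff₀ hN']
          linarith
        exact .inr (Finset.mem_filter.2 ⟨hk.1, by simp [h0, hk.2]⟩)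
    have h1 := (Finset.card_le_card hsub).trans (Finset.card_union_le _ _)
    have h2 := card_le_of_forall_lt (c := N * (y + γ)) (by positivity)
      ((Finset.range N).filter fun k : ℕ ↦ (k : ℝ) < N * (y + γ)) (by simp)
    have h3 : (((Finset.range N).filter q).card : ℝ) ≤ _ := Nat.cast_le.2 h1
    push_cast at h3
    linarith
  have hlow : (N : ℝ) ≤ ((Finset.range N).filter q).card + (N - N * (y - γ)) + bad.card := by
    have hsub : (Finset.range N).filter (¬ q ·) ⊆
        ((Finset.range N).filter fun k : ℕ ↦ N * ((y : ℝ) - γ) < (k : ℝ)) ∪ bad := by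
      intro k hk
      rw [Finset.mem_filter] at hk
      rw [Finset.mem_union, Finset.mem_filter]
      by_cases hlt : N * ((y : ℝ) - γ) < (k : ℝ)
      · exact .inl ⟨hk.1, hlt⟩
      · have h0 : psi ((k : ℝ) / N) γ y = DCLabel.one := by
          rw [psi_eq_one_iff, ← le_sub_iff_add_le, div_le_iff₀ hN']
          linarith
        exact .inr (Finset.mem_filter.2 ⟨hk.1, by simp [h0, hk.2]⟩)
    have h1 := (Finset.card_le_card hsub).trans (Finset.card_union_le _ _)
    have h2 := card_le_of_forall_gt N (c := N * (y - γ)) (by nlinarith)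
      ((Finset.range N).filter fun k : ℕ ↦ N * ((y : ℝ) - γ) < (k : ℝ)) (by simp)
    have h3 : (((Finset.range N).filter (¬ q ·)).card : ℝ) ≤ _ := Nat.cast_le.2 h1
    have h4 := Finset.card_filter_add_card_filter_not (s := Finset.range N) q
    rw [Finset.card_range] at h4
    have h5 : (((Finset.range N).filter q).card : ℝ) + ((Finset.range N).filter (¬ q ·)).card = N :=
      mod_cast h4
    push_cast at h3
    linarith
  have hdiv : γ + 1 / N + (bad.card : ℝ) / N = (N * γ + 1 + bad.card) / N := by
    field_simp
  have hdiv' : (((Finset.range N).filter q).card : ℝ) / N - y =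
      (((Finset.range N).filter q).card - N * y) / N := by
    field_simp
  rw [hdiv, hdiv', abs_div, abs_of_pos hN']
  gcongr
  rw [abs_le]
  constructor <;> linarith

open Classical in
theorem exists_strategy_leaveOneOut {X : Type*} (F : Set (X → I)) {γ : ℝ} (hγ : 0 < γ) (d : ℕ)
    (hd : ∀ (n : ℕ) (x : Fin n → X), FatlyVapnikShattered F γ x → n ≤ d) {N : ℕ} (hN : 0 < N) :
    ∃ A : PredictionStrategy X, ∀ f ∈ F, ∀ (m : ℕ) (x : Fin m → X) (L : Fin m → List (X × I)),
      IsLeaveOneOut f x L →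
      ∑ i, |(A (L i) (x i) : ℝ) - f (x i)| ≤ d + m * (γ + 1 / N) := by
  have hN' : (0 : ℝ) < N := Nat.cast_pos.2 hN
  choose h hh using exists_threshold_rule F γ d hd
  -- The value 0 for `k ≥ N` is never used.
  let r : ℕ → I := fun k ↦ if hk : k < N then
    ⟨(k : ℝ) / N, by positivity, (div_le_one hN').2 (Nat.cast_le.2 hk.le)⟩ else 0
  have hr : ∀ k < N, (r k : ℝ) = k / N := fun k hk ↦ by simp [r, hk]
  refine ⟨fun L a ↦ ⟨(((Finset.range N).filter fun k ↦ h (r k) L a).card : ℝ) / N, by positivity,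
    (div_le_one hN').2 (Nat.cast_le.2 ((Finset.card_filter_le _ _).trans_eq
      (Finset.card_range N)))⟩, fun f hf m x L hL ↦ ?_⟩
  let bad : Fin m → ℕ → Prop := fun i k ↦ psi ((k : ℝ) / N) γ (f (x i)) ≠ DCLabel.star ∧
    ¬ (h (r k) (L i) (x i) ↔ psi ((k : ℝ) / N) γ (f (x i)) = DCLabel.one)
  -- Double counting: each of the `N` thresholds has at most `d` bad indices.
  have hcount : ∑ i, ((Finset.range N).filter (bad i)).card ≤ N * d := by
    have hswap : ∑ i, ((Finset.range N).filter (bad i)).card =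
        ∑ k ∈ Finset.range N, (Finset.univ.filter fun i ↦ bad i k).card := by
      simp only [Finset.card_filter]
      exact Finset.sum_comm
    rw [hswap]
    refine (Finset.sum_le_card_nsmul _ _ d fun k hk ↦ ?_).trans_eq (by simp)
    refine hh (r k) f hf m x L hL _ fun i hi ↦ ?_
    rw [hr k (Finset.mem_range.1 hk)]
    exact (Finset.mem_filter.1 hi).2
  calc _ ≤ ∑ i, (γ + 1 / N + (((Finset.range N).filter (bad i)).card : ℝ) / N) :=
        Finset.sum_le_sum fun i _ ↦ abs_card_filter_div_sub_le hN hγ (f (x i)) _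
    _ = m * (γ + 1 / N) + ((∑ i, ((Finset.range N).filter (bad i)).card : ℕ) : ℝ) / N := by
        rw [Finset.sum_add_distrib, ← Finset.sum_div, Finset.sum_const, Finset.card_univ,
          Fintype.card_fin, nsmul_eq_mul, Nat.cast_sum]
    _ ≤ m * (γ + 1 / N) + d := by
        gcongr
        rw [div_le_iff₀ hN', mul_comm]
        exact mod_cast hcount
    _ = _ := add_comm _ _

/-! ### Exchangeability and the limit -/

theorem isLeaveOneOut_trainingSample {X : Type*} (f : X → I) {m : ℕ} (hm : 0 < m) (x : Fin m → X) :
    IsLeaveOneOut f x fun i ↦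
      trainingSample f (x ∘ Equiv.swap i ⟨m - 1, Nat.sub_lt hm Nat.one_pos⟩) := by
  intro i z
  set l : Fin m := ⟨m - 1, Nat.sub_lt hm Nat.one_pos⟩ with hl
  simp only [trainingSample, List.mem_ofFn', Set.mem_range, Function.comp_apply]
  constructor
  · rintro ⟨k, rfl⟩
    refine ⟨_, fun h ↦ ?_, rfl⟩
    rw [Equiv.swap_apply_eq_iff, Equiv.swap_apply_left, Fin.ext_iff] at h
    exact k.2.ne h
  · rintro ⟨j, hj, rfl⟩
    have hne : Equiv.swap i l j ≠ l := by
      rwa [Ne, Equiv.swap_apply_eq_iff, Equiv.swap_apply_right]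
    have hlt : (Equiv.swap i l j : ℕ) < m - 1 := by
      have h1 := (Equiv.swap i l j).2
      have h2 : (Equiv.swap i l j : ℕ) ≠ m - 1 := fun h ↦ hne (Fin.ext h)
      omega
    refine ⟨⟨_, hlt⟩, ?_⟩
    have : (Fin.castLE (Nat.sub_le m 1) ⟨_, hlt⟩ : Fin m) = Equiv.swap i l j := rfl
    rw [this, Equiv.swap_apply_self]

/-- Lower integrals are superadditive without measurability, and this is the direction needed. -/
theorem MeasureTheory.sum_lintegral_le_lintegral_sum {α ι : Type*} [MeasurableSpace α]
    (μ : Measure α) (s : Finset ι) (g : ι → α → ℝ≥0∞) :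
    ∑ i ∈ s, ∫⁻ a, g i a ∂μ ≤ ∫⁻ a, ∑ i ∈ s, g i a ∂μ := by
  classical
  induction s using Finset.induction_on with
  | empty => simp
  | insert i s hi ih =>
    simp only [Finset.sum_insert hi]
    exact (add_le_add_right ih _).trans (le_lintegral_add _ _)

theorem MeasureTheory.lintegral_pi_comp_perm {X ι : Type*} [MeasurableSpace X] [Fintype ι]
    (μ : Measure X) [SigmaFinite μ] (e : Equiv.Perm ι) (g : (ι → X) → ℝ≥0∞) :
    ∫⁻ x, g (x ∘ e) ∂(Measure.pi fun _ ↦ μ) = ∫⁻ x, g x ∂(Measure.pi fun _ ↦ μ) := by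
  have h := measurePreserving_arrowCongr' (fun _ : ι ↦ μ) (fun _ : ι ↦ μ) e.symm
    (MeasurableEquiv.refl X) fun _ ↦ MeasurePreserving.id μ
  exact h.lintegral_comp_emb (MeasurableEquiv.measurableEmbedding _) g

/-- A function whose sum over all exchanges of a coordinate with the coordinate `l` is bounded by
`c` has lower integral at most `c` divided by the number of coordinates. -/
theorem MeasureTheory.card_mul_lintegral_pi_le {X ι : Type*} [MeasurableSpace X] [Fintype ι]
    [DecidableEq ι] (μ : Measure X) [IsProbabilityMeasure μ] (l : ι) (g : (ι → X) → ℝ≥0∞)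
    (c : ℝ≥0∞) (hg : ∀ x, ∑ i, g (x ∘ Equiv.swap i l) ≤ c) :
    Fintype.card ι * ∫⁻ x, g x ∂(Measure.pi fun _ ↦ μ) ≤ c := by
  calc _ = ∑ i, ∫⁻ x, g (x ∘ Equiv.swap i l) ∂(Measure.pi fun _ ↦ μ) := by
        simp [lintegral_pi_comp_perm μ]
    _ ≤ _ := sum_lintegral_le_lintegral_sum _ _ _
    _ ≤ ∫⁻ _, c ∂(Measure.pi fun _ : ι ↦ μ) := lintegral_mono hg
    _ = c := by simp

theorem predictionLoss_le_of_pos {X : Type*} [MeasurableSpace X] (F : Set (X → I)) {γ : ℝ}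
    (hγ : 0 < γ) (m : ℕ) (hm : 0 < m) (d : ℕ)
    (hd : ∀ (n : ℕ) (x : Fin n → X), FatlyVapnikShattered F γ x → n ≤ d) {N : ℕ} (hN : 0 < N) :
    predictionLoss F m hm ≤ d / (m : ℝ≥0∞) + ENNReal.ofReal (γ + 1 / N) := by
  obtain ⟨A, hA⟩ := exists_strategy_leaveOneOut F hγ d hd hN
  refine iInf_le_of_le A (iSup_le fun D ↦ iSup₂_le fun f hf ↦ ?_)
  have hm0 : (m : ℝ≥0∞) ≠ 0 := by exact_mod_cast hm.ne'
  have hmt : (m : ℝ≥0∞) ≠ ⊤ := ENNReal.natCast_ne_top m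
  have key := card_mul_lintegral_pi_le (D : Measure X) (⟨m - 1, Nat.sub_lt hm Nat.one_pos⟩ : Fin m)
    (fun x ↦ ENNReal.ofReal (predictionError A f hm x)) (ENNReal.ofReal (d + m * (γ + 1 / N)))
    fun x ↦ by
      rw [← ENNReal.ofReal_sum_of_nonneg fun i _ ↦ by exact abs_nonneg _]
      refine ENNReal.ofReal_le_ofReal ?_
      have := hA f hf m x _ (isLeaveOneOut_trainingSample f hm x)
      simpa [predictionError, lastPoint] using this
  rw [Fintype.card_fin, mul_comm, ← ENNReal.le_div_iff_mul_le (.inl hm0) (.inl hmt)] at key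
  refine key.trans_eq ?_
  rw [ENNReal.ofReal_add (by positivity) (by positivity), ENNReal.ofReal_mul (by positivity),
    ENNReal.ofReal_natCast, ENNReal.ofReal_natCast, ENNReal.add_div, mul_comm (m : ℝ≥0∞),
    ENNReal.mul_div_cancel_right hm0 hmt]

theorem le_of_fatV_eq_coe {X : Type*} {F : Set (X → I)} {γ : ℝ} {d : ℕ} (h : fatV F γ = d) (n : ℕ)
    (x : Fin n → X) (hx : FatlyVapnikShattered F γ x) : n ≤ d := by
  have : (n : ℕ∞) ≤ fatV F γ := le_iSup₂_of_le n ⟨x, hx⟩ le_rfl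
  rw [h] at this
  exact_mod_cast this

theorem theoremt {X : Type*} [MeasurableSpace X] (F : Set (X → I)) (γ : ℝ) (hγ : 0 < γ)
    (m : ℕ) (hm : 0 < m) :
    predictionLoss F m hm ≤ ((fatV F γ : ℕ∞) : ℝ≥0∞) / (m : ℝ≥0∞) + ENNReal.ofReal γ := by
  cases h : fatV F γ with
  | top => simp [ENNReal.top_div]
  | coe d =>
    rw [ENat.toENNReal_coe]
    -- The strategy depends on `N`, but the loss is an infimum over strategies, so only the bounds
    -- need to converge.
    have hlim : Filter.Tendsto (fun N : ℕ ↦ (d : ℝ≥0∞) / m + ENNReal.ofReal (γ + 1 / N))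
        Filter.atTop (nhds (d / m + ENNReal.ofReal γ)) := by
      refine tendsto_const_nhds.add (ENNReal.tendsto_ofReal ?_)
      simpa using tendsto_const_nhds.add (tendsto_const_div_atTop_nhds_zero_nat (1 : ℝ))
    exact ge_of_tendsto hlim (Filter.eventually_atTop.2
      ⟨1, fun N hN ↦ predictionLoss_le_of_pos F hγ m hm d (le_of_fatV_eq_coe h) hN⟩)
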